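/- Let $\mathbb K\in\{\mathbb R,\mathbb C\}$ and let $\Omega\subseteq\mathbb R^3$ be open; $L_2(\Omega)$ and $L_2(\Omega)^3$ consist of $\mathbb K$-valued functions and $\mathbb K^3$-valued fields. Let $\mathring{\mathrm{grad}}$ be the gradient with domain $H_0^1(\Omega)$ (the closure of $C_c^\infty(\Omega)$ in $H^1(\Omega)$), let $\mathrm{div}=-\mathring{\mathrm{grad}}^{*}$ be the $L_2$-divergence with maximal domain, let $\mathrm{curl}$ be the distributional curl in $L_2(\Omega)^3$ with maximal domain, and $\mathring{\mathrm{curl}}=\mathrm{curl}^*$. Let $H^{-1}(\Omega)=H_0^1(\Omega)^*$; for $F\in L_2(\Omega)^3$ the distributional divergence $\mathrm{div}\,F\in H^{-1}(\Omega)$ is the functional $u\mapsto-\langle F,\mathring{\mathrm{grad}}\,u\rangle$ (scalar products are antilinear in the first argument). Assume that $\Omega$ has the electric compactness property: $\mathrm{dom}(\mathrm{div})\cap\mathrm{dom}(\mathring{\mathrm{curl}})$, with its graph norm, embeds compactly into $L_2(\Omega)^3$. Put $\mathcal H_0=\mathrm{ran}(\mathring{\mathrm{grad}})$ (which is then closed),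 $\mathcal H_1=\mathcal H_0^\perp$ in $\mathcal H=L_2(\Omega)^3$, let $\iota_j\colon\mathcal H_j\hookrightarrow\mathcal H$ be the embeddings, and $a_{jk}=\iota_j^*a\iota_k$ for $a\in\mathcal B(\mathcal H)$. Let $\mathcal M$ be the set of all $a\in\mathcal B(\mathcal H)$ such that $a$ and $a_{00}$ are boundedly invertible, and let $\tau$ be the initial topology on $\mathcal M$ with respect to the maps $a\mapsto a_{00}^{-1}$, $a_{00}^{-1}a_{01}$, $a_{10}a_{00}^{-1}$, $a_{11}-a_{10}a_{00}^{-1}a_{01}$ into the respective operator spaces with the weak operator topology. For $\lambda>0$ let $B(\lambda)\subseteq\mathcal M$ be the set of all $a$ for which these four operators have norm at most $\lambda$. Let $\tau_{\mathrm{bH}}$ be the final topology on $\mathcal M$ with respect to the inclusions $(B(\lambda),\tau|_{B(\lambda)})\hookrightarrow\mathcal M$, $\lambda>0$. Let $(\varepsilon_n)_{n}$ be a bounded sequence in $\mathcal B(L_2(\Omega)^3)$ and $\varepsilon_0\in\mathcal B(L_2(\Omega)^3)$. Assume that there is $c>0$ with $\mathrm{Re}\,\langle F,\varepsilon_nF\rangle\ge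 c\|F\|^2$ for all $n$ and all $F\in L_2(\Omega)^3$; that for every $F\in L_2(\Omega)^3$ the set $\{\mathrm{div}\,\varepsilon_nF:\ n\}$ is relatively compact in $H^{-1}(\Omega)$; and that $\varepsilon_n\to\varepsilon_0$ both in the weak operator topology and in $\tau_{\mathrm{bH}}$. Let $(E_n)_n$ be a bounded sequence in $L_2(\Omega)^3$ such that $\varepsilon_nE_n\in\mathrm{dom}(\mathrm{div})$ and $E_n\in\mathrm{dom}(\mathring{\mathrm{curl}})$ for all $n$, and such that $(\mathrm{div}\,\varepsilon_nE_n)_n$ is bounded in $L_2(\Omega)$ and $(\mathring{\mathrm{curl}}\,E_n)_n$ is bounded in $L_2(\Omega)^3$. Then $(E_n)_n$ has a subsequence that converges strongly in $L_2(\Omega)^3$. -/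

import Mathlib

open MeasureTheory Filter Topology TopologicalSpace

noncomputable section

namespace ElectroStatics

/-! ### Square integrable functions and fields -/

/-- Three-dimensional Euclidean space. -/
abbrev R3 : Type := EuclideanSpace ℝ (Fin 3)

/-- The Hilbert space `L₂(Ω)` of `𝕜`-valued square integrable functions. -/
abbrev L2 (𝕜 : Type*) [RCLike 𝕜] (Ω : Opens R3) : Type _ :=
  Lp 𝕜 2 (volume.restrict (Ω : Set R3))

/-- The Hilbert space `L₂(Ω)³` of `𝕜`-valued square integrable vector fields. -/
abbrev L2Vec (𝕜 : Type*) [RCLike 𝕜] (Ω : Opens R3) : Type _ :=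
  Lp (EuclideanSpace 𝕜 (Fin 3)) 2 (volume.restrict (Ω : Set R3))

/-! ### Vector analytic operators

Closed operators between Hilbert spaces are represented by their graphs, which are subspaces of
the product space: `(x, y)` belongs to the graph of `C` if and only if `x` lies in the domain of
`C` and `C x = y`. -/

/-- The partial derivative of `F` in the `i`-th coordinate direction. -/
def partialD {V : Type*} [NormedAddCommGroup V] [NormedSpace ℝ V] (i : Fin 3) (F : R3 → V)
    (x : R3) : V :=
  fderiv ℝ F x (EuclideanSpace.single i 1)

/-- The classical gradient of a scalar function. -/
def classicalGrad {𝕜 : Type*} [RCLike 𝕜] (φ : R3 → 𝕜) (x : R3) : EuclideanSpace 𝕜 (Fin 3) :=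
  !₂[partialD 0 φ x, partialD 1 φ x, partialD 2 φ x]

/-- The classical curl of a vector field. -/
def classicalCurl {𝕜 : Type*} [RCLike 𝕜] (Φ : R3 → EuclideanSpace 𝕜 (Fin 3)) (x : R3) :
    EuclideanSpace 𝕜 (Fin 3) :=
  !₂[partialD 1 Φ x 2 - partialD 2 Φ x 1,
     partialD 2 Φ x 0 - partialD 0 Φ x 2,
     partialD 0 Φ x 1 - partialD 1 Φ x 0]

lemma classicalGrad_add {𝕜 : Type*} [RCLike 𝕜] {φ ψ : R3 → 𝕜} (hφ : Differentiable ℝ φ)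
    (hψ : Differentiable ℝ ψ) :
    classicalGrad (φ + ψ) = classicalGrad φ + classicalGrad ψ := by
  funext x
  have h : ∀ i, partialD i (φ + ψ) x = partialD i φ x + partialD i ψ x := fun i => by
    simp [partialD, fderiv_add (hφ x) (hψ x)]
  ext i
  fin_cases i <;> simp [classicalGrad, h]

lemma classicalGrad_smul {𝕜 : Type*} [RCLike 𝕜] (c : 𝕜) {φ : R3 → 𝕜}
    (hφ : Differentiable ℝ φ) :
    classicalGrad (c • φ) = c • classicalGrad φ := by
  funext x
  have h : ∀ i, partialD i (c • φ) x = c * partialD i φ x := fun i => by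
    simp [partialD, fderiv_const_smul (hφ x) c]
  ext i
  fin_cases i <;> simp [classicalGrad, h]

/-- The graph of the gradient on `C_c^∞(Ω)`. -/
def testGrad (𝕜 : Type*) [RCLike 𝕜] (Ω : Opens R3) : Submodule 𝕜 (L2 𝕜 Ω × L2Vec 𝕜 Ω) where
  carrier := {p | ∃ φ : TestFunction Ω 𝕜 ⊤,
    p.1 =ᵐ[volume.restrict (Ω : Set R3)] φ ∧
      p.2 =ᵐ[volume.restrict (Ω : Set R3)] classicalGrad φ}
  zero_mem' := by
    refine ⟨0, Lp.coeFn_zero _ _ _, ?_⟩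
    filter_upwards [Lp.coeFn_zero (EuclideanSpace 𝕜 (Fin 3)) 2
      (volume.restrict (Ω : Set R3))] with x hx
    have h0 : (⇑(0 : TestFunction Ω 𝕜 ⊤) : R3 → 𝕜) = fun _ => 0 := rfl
    rw [Prod.snd_zero, hx, h0]
    ext i
    fin_cases i <;> simp [classicalGrad, partialD]
  add_mem' := by
    rintro p q ⟨φ, hφ, hφ'⟩ ⟨ψ, hψ, hψ'⟩
    refine ⟨φ + ψ, (Lp.coeFn_add _ _).trans (hφ.add hψ), (Lp.coeFn_add _ _).trans ?_⟩
    have h := classicalGrad_add (φ.contDiff.differentiable (by simp))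
      (ψ.contDiff.differentiable (by simp))
    have h' : (⇑(φ + ψ) : R3 → 𝕜) = ⇑φ + ⇑ψ := rfl
    rw [h', h]
    exact hφ'.add hψ'
  smul_mem' := by
    rintro c p ⟨φ, hφ, hφ'⟩
    refine ⟨c • φ, (Lp.coeFn_smul _ _).trans (hφ.const_smul c), (Lp.coeFn_smul _ _).trans ?_⟩
    have h := classicalGrad_smul c (φ.contDiff.differentiable (by simp))
    have h' : (⇑(c • φ) : R3 → 𝕜) = c • ⇑φ := rfl
    rw [h', h]
    exact hφ'.const_smul c

/-- The graph of the gradient with domain `H₀¹(Ω)`, the closure of `C_c^∞(Ω)` in `H¹(Ω)`. -/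
def gradZero (𝕜 : Type*) [RCLike 𝕜] (Ω : Opens R3) : Submodule 𝕜 (L2 𝕜 Ω × L2Vec 𝕜 Ω) :=
  (testGrad 𝕜 Ω).topologicalClosure

/-- The graph of the `L₂`-divergence with maximal domain. Since the adjoint of the gradient on
`H₀¹(Ω)` is minus the divergence, `(F, f)` is in this graph if and only if `(F, -f)` is in the
graph of the adjoint. -/
def divergence (𝕜 : Type*) [RCLike 𝕜] (Ω : Opens R3) : Submodule 𝕜 (L2Vec 𝕜 Ω × L2 𝕜 Ω) :=
  (gradZero 𝕜 Ω).adjoint.comap (LinearMap.id.prodMap (-LinearMap.id))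

/-- `K` is the weak (distributional) curl of `H` in `Ω`. -/
def IsWeakCurl {𝕜 : Type*} [RCLike 𝕜] (Ω : Opens R3) (H K : L2Vec 𝕜 Ω) : Prop :=
  ∀ Φ : TestFunction Ω (EuclideanSpace 𝕜 (Fin 3)) ⊤,
    ∫ x in (Ω : Set R3), inner 𝕜 (classicalCurl Φ x) (H x) =
      ∫ x in (Ω : Set R3), inner 𝕜 (Φ x) (K x)

/-- The graph of the adjoint of the `L₂`-curl with maximal domain, that is, of the curl with
vanishing tangential component at the boundary: `(E, G)` is in this graph if and only if
`⟪curl H, E⟫ = ⟪H, G⟫` for all `H` in the domain of the curl. -/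
def curlZero (𝕜 : Type*) [RCLike 𝕜] (Ω : Opens R3) : Submodule 𝕜 (L2Vec 𝕜 Ω × L2Vec 𝕜 Ω) where
  carrier := {p | ∀ H K : L2Vec 𝕜 Ω, IsWeakCurl Ω H K → inner 𝕜 K p.1 = inner 𝕜 H p.2}
  zero_mem' := fun H K _ => by simp
  add_mem' := fun hp hq H K h => by
    simp only [Prod.fst_add, Prod.snd_add, inner_add_right, hp H K h, hq H K h]
  smul_mem' := fun c p hp H K h => by
    simp only [Prod.smul_fst, Prod.smul_snd, inner_smul_right, hp H K h]

/-- The electric compactness property: the intersection of the domains of the divergence and of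
the curl with vanishing tangential component, with its graph norm, embeds compactly into
`L₂(Ω)³`, that is, its unit ball is relatively compact in `L₂(Ω)³`. -/
def ElectricCompactness (𝕜 : Type*) [RCLike 𝕜] (Ω : Opens R3) : Prop :=
  IsCompact (closure {E : L2Vec 𝕜 Ω | ∃ (f : L2 𝕜 Ω) (G : L2Vec 𝕜 Ω),
    (E, f) ∈ divergence 𝕜 Ω ∧ (E, G) ∈ curlZero 𝕜 Ω ∧ ‖E‖ ^ 2 + ‖f‖ ^ 2 + ‖G‖ ^ 2 ≤ 1})

/-! ### The space `H⁻¹(Ω)` -/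

/-- The Hilbert space `H₀¹(Ω)` with the graph scalar product of the gradient: its elements are
the pairs of a function in `H₀¹(Ω)` and its gradient. -/
def H01 (𝕜 : Type*) [RCLike 𝕜] (Ω : Opens R3) :
    Submodule 𝕜 (WithLp 2 (L2 𝕜 Ω × L2Vec 𝕜 Ω)) :=
  (gradZero 𝕜 Ω).comap (WithLp.linearEquiv 2 𝕜 (L2 𝕜 Ω × L2Vec 𝕜 Ω)).toLinearMap

/-- The dual space `H⁻¹(Ω)` of `H₀¹(Ω)`. -/
abbrev HNeg1 (𝕜 : Type*) [RCLike 𝕜] (Ω : Opens R3) : Type _ := StrongDual 𝕜 (H01 𝕜 Ω)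

/-- The distributional divergence of `F` in `L₂(Ω)³` as an element of `H⁻¹(Ω)`: the functional
`u ↦ -⟪F, grad u⟫`. -/
def divDist {𝕜 : Type*} [RCLike 𝕜] (Ω : Opens R3) (F : L2Vec 𝕜 Ω) : HNeg1 𝕜 Ω :=
  -((innerSL 𝕜 F).comp ((WithLp.sndL 2 𝕜 (L2 𝕜 Ω) (L2Vec 𝕜 Ω)).comp (H01 𝕜 Ω).subtypeL))

/-! ### Nonlocal `H`-convergence

Let `V` be a closed subspace of a Hilbert space `X`. With respect to the orthogonal decomposition
of `X` into `V` (index `0`) and its orthogonal complement (index `1`), a bounded operator `a` on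
`X` is a block operator matrix with entries `a₀₀`, `a₀₁`, `a₁₀`, `a₁₁`. -/

section Schur

variable {𝕜 X : Type*} [RCLike 𝕜] [NormedAddCommGroup X] [InnerProductSpace 𝕜 X]

/-- The compression `ι_U^* a ι_W` of `a` to an operator from `W` to `U`. -/
def block (U W : Submodule 𝕜 X) [U.HasOrthogonalProjection] (a : X →L[𝕜] X) : W →L[𝕜] U :=
  (U.orthogonalProjectionOnto.comp a).comp W.subtypeL

variable (V : Submodule 𝕜 X) [V.HasOrthogonalProjection]

/-- The set of all boundedly invertible `a` such that `a₀₀` is boundedly invertible. -/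
def schurSet : Set (X →L[𝕜] X) := {a | IsUnit a ∧ IsUnit (block V V a)}

/-- The operator `a₀₀⁻¹`. -/
def schur00 (a : X →L[𝕜] X) : V →L[𝕜] V := Ring.inverse (block V V a)

/-- The operator `a₀₀⁻¹ a₀₁`. -/
def schur01 (a : X →L[𝕜] X) : Vᗮ →L[𝕜] V := (schur00 V a).comp (block V Vᗮ a)

/-- The operator `a₁₀ a₀₀⁻¹`. -/
def schur10 (a : X →L[𝕜] X) : V →L[𝕜] Vᗮ := (block Vᗮ V a).comp (schur00 V a)

/-- The Schur complement `a₁₁ - a₁₀ a₀₀⁻¹ a₀₁`. -/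
def schur11 (a : X →L[𝕜] X) : Vᗮ →L[𝕜] Vᗮ :=
  block Vᗮ Vᗮ a - (block Vᗮ V a).comp ((schur00 V a).comp (block V Vᗮ a))

/-- The topology of nonlocal `H`-convergence: the initial topology with respect to the four maps
above, where the spaces of operators carry the weak operator topology. -/
@[reducible] def schurTopology : TopologicalSpace (schurSet V) :=
  .induced (fun a => ContinuousLinearMapWOT.ofCLM (schur00 V a.1)) inferInstance ⊓
  .induced (fun a => ContinuousLinearMapWOT.ofCLM (schur01 V a.1)) inferInstance ⊓
  .induced (fun a => ContinuousLinearMapWOT.ofCLM (schur10 V a.1)) inferInstance ⊓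
  .induced (fun a => ContinuousLinearMapWOT.ofCLM (schur11 V a.1)) inferInstance

/-- The set of operators with bound at most `r` for the topology of nonlocal `H`-convergence. -/
def schurBall (r : ℝ) : Set (schurSet V) :=
  {a | ‖schur00 V a.1‖ ≤ r ∧ ‖schur01 V a.1‖ ≤ r ∧ ‖schur10 V a.1‖ ≤ r ∧ ‖schur11 V a.1‖ ≤ r}

/-- The topology of bounded nonlocal `H`-convergence: the final topology with respect to the
inclusions of the sets `schurBall V r`, `r > 0`, with the relative topologies induced by
`schurTopology V`. -/
@[reducible] def boundedSchurTopology : TopologicalSpace (schurSet V) :=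
  ⨆ (r : ℝ) (_ : 0 < r),
    .coinduced (Subtype.val : schurBall V r → schurSet V)
      (.induced (Subtype.val : schurBall V r → schurSet V) (schurTopology V))

/-- The sequence `ε` and its limit `ε₀` lie in `schurSet V`, and `ε` converges to `ε₀` in the
topology of bounded nonlocal `H`-convergence. -/
def TendstoBoundedSchur (ε : ℕ → X →L[𝕜] X) (ε₀ : X →L[𝕜] X) : Prop :=
  ∃ (h : ∀ n, ε n ∈ schurSet V) (h₀ : ε₀ ∈ schurSet V),
    Tendsto (fun n => (⟨ε n, h n⟩ : schurSet V)) atTop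
      (@nhds _ (boundedSchurTopology V) ⟨ε₀, h₀⟩)

end Schur

/-- The closure in `L₂(Ω)³` of the range of the gradient on `H₀¹(Ω)`. (If `Ω` has the electric
compactness property, then this range is closed.) -/
def ranGradZero (𝕜 : Type*) [RCLike 𝕜] (Ω : Opens R3) : Submodule 𝕜 (L2Vec 𝕜 Ω) :=
  ((gradZero 𝕜 Ω).map (LinearMap.snd 𝕜 (L2 𝕜 Ω) (L2Vec 𝕜 Ω))).topologicalClosure

instance (𝕜 : Type*) [RCLike 𝕜] (Ω : Opens R3) : CompleteSpace (ranGradZero 𝕜 Ω) :=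
  (Submodule.isClosed_topologicalClosure _).completeSpace_coe

end ElectroStatics

end

/-!
Let `P` be the orthogonal projection of `L₂(Ω)³` onto the closure `V` of the gradients of `H₀¹(Ω)`.
Gradients are curl-free and fields orthogonal to `V` are divergence-free, so `P` splits the two
differential constraints: `E n - P (E n)` is divergence-free with the curl of `E n`, and
`P (ε n (E n))` is curl-free with the divergence of `ε n (E n)`. By electric compactness both have
strongly convergent subsequences, with limits `y` and `g` (`ElectricCompactness.exists_tendsto`).

It remains to recover `P (E n)`. Electric compactness implies that the divergence is bounded below on
`V`, and by duality a Poincaré inequality for potentials of gradients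
(`ElectricCompactness.exists_potential`); hence `‖P F‖` is bounded by the norm of `div F` in
`H⁻¹(Ω)`. Relative compactness of the functionals `div (ε n F)` and weak convergence
`ε n F → ε₀ F` therefore give strong convergence `P (ε n F) → P (ε₀ F)` for each `F`
(`ElectricCompactness.tendsto_starProjection`). Since the compression of `ε₀` to `V` is invertible,
there is `x ∈ V` with `P (ε₀ (x + y)) = g`. Then `P (ε n (E n - (x + y))) → 0` along the
subsequence, while the component of `E n - (x + y)` orthogonal to `V` tends to zero, and coercivity of
`ε n` yields `E n → x + y` (`exists_tendsto_of_coercive`).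
-/

namespace ElectroStatics

/-! ### Closed operators between Hilbert spaces -/

section Hilbert

variable {𝕜 X Y : Type*} [RCLike 𝕜] [NormedAddCommGroup X] [InnerProductSpace 𝕜 X]
  [NormedAddCommGroup Y] [InnerProductSpace 𝕜 Y]

/-- A closed operator is contained in (indeed equal to) the adjoint of its adjoint. -/
lemma mem_of_forall_mem_adjoint [CompleteSpace X] [CompleteSpace Y] {g : Submodule 𝕜 (X × Y)}
    (hg : IsClosed (g : Set (X × Y))) {x : X} {y : Y}
    (h : ∀ v f, (v, f) ∈ g.adjoint → inner 𝕜 v y = inner 𝕜 f x) : (x, y) ∈ g := by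
  set g' : Submodule 𝕜 (WithLp 2 (X × Y)) :=
    g.comap (WithLp.linearEquiv 2 𝕜 (X × Y)).toLinearMap
  have hcl : IsClosed (g' : Set (WithLp 2 (X × Y))) :=
    hg.preimage (WithLp.prod_continuous_ofLp 2 X Y)
  have : CompleteSpace g' := hcl.completeSpace_coe
  have hmem : WithLp.toLp 2 (x, y) ∈ g'ᗮᗮ := by
    rw [Submodule.mem_orthogonal]
    intro p hp
    have hp' : (p.snd, -p.fst) ∈ g.adjoint := by
      rw [Submodule.mem_adjoint_iff]
      intro a b hab
      have := (Submodule.mem_orthogonal _ _).1 hp (WithLp.toLp 2 (a, b)) hab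
      rw [WithLp.prod_inner_apply] at this
      simpa [add_comm] using this
    have := h _ _ hp'
    rw [inner_neg_left] at this
    rw [WithLp.prod_inner_apply]
    simpa [add_comm] using eq_neg_iff_add_eq_zero.1 this
  rw [Submodule.orthogonal_orthogonal] at hmem
  exact hmem

/-- If the adjoint of a closed operator satisfies `‖v‖ ≤ C * ‖f‖`, where `f` is its value at `v`, for
all `v` in a closed subspace that contains the range of the operator, then every `w` in this
range has a preimage of norm at most `C * ‖w‖`, namely the orthogonal projection of any preimage to the
closure of the range of the adjoint. -/
lemma exists_preimage_norm_le [CompleteSpace X] [CompleteSpace Y] {g : Submodule 𝕜 (X × Y)}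
    (hg : IsClosed (g : Set (X × Y))) {V : Submodule 𝕜 Y} [V.HasOrthogonalProjection]
    (hV : ∀ u w, (u, w) ∈ g → w ∈ V) {C : ℝ} (hC₀ : 0 ≤ C)
    (hC : ∀ v ∈ V, ∀ f, (v, f) ∈ g.adjoint → ‖v‖ ≤ C * ‖f‖) {u : X} {w : Y} (huw : (u, w) ∈ g) :
    ∃ u₀, (u₀, w) ∈ g ∧ ‖u₀‖ ≤ C * ‖w‖ := by
  set K : Submodule 𝕜 X := (g.adjoint.map (LinearMap.snd 𝕜 Y X)).topologicalClosure
  have : CompleteSpace K := (Submodule.isClosed_topologicalClosure _).completeSpace_coe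
  have hK : ∀ v f, (v, f) ∈ g.adjoint → f ∈ K := fun v f h =>
    Submodule.le_topologicalClosure _ ⟨(v, f), h, rfl⟩
  have horth : ∀ f ∈ K, inner 𝕜 f (u - K.starProjection u) = 0 := fun f hf =>
    (Submodule.mem_orthogonal _ _).1 (K.sub_starProjection_mem_orthogonal u) f hf
  -- `u` minus its projection is orthogonal to the range of the adjoint, hence in the kernel.
  have hker : (u - K.starProjection u, (0 : Y)) ∈ g := by
    refine mem_of_forall_mem_adjoint hg fun v f h => ?_
    rw [inner_zero_right, horth f (hK v f h)]
  refine ⟨K.starProjection u, by simpa using g.sub_mem huw hker, ?_⟩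
  have key : ∀ x ∈ K, ‖inner 𝕜 x (K.starProjection u)‖ ≤ C * ‖w‖ * ‖x‖ := by
    have hclosed : IsClosed {x : X | ‖inner 𝕜 x (K.starProjection u)‖ ≤ C * ‖w‖ * ‖x‖} :=
      isClosed_le (by fun_prop) (by fun_prop)
    refine fun x hx => closure_minimal ?_ hclosed hx
    rintro _ ⟨⟨v, f⟩, hvf, rfl⟩
    change ‖inner 𝕜 f (K.starProjection u)‖ ≤ C * ‖w‖ * ‖f‖
    have h0 : (v - V.starProjection v, (0 : X)) ∈ g.adjoint := by
      rw [Submodule.mem_adjoint_iff]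
      intro a b hab
      simpa using (Submodule.mem_orthogonal _ _).1 (V.sub_starProjection_mem_orthogonal v) b
        (hV a b hab)
    have h1 : (V.starProjection v, f) ∈ g.adjoint := by simpa using g.adjoint.sub_mem hvf h0
    have h2 := hC _ (V.starProjection_apply_mem v) f h1
    have h3 := sub_eq_zero.1 ((Submodule.mem_adjoint_iff _ _).1 h1 u w huw)
    have h4 : inner 𝕜 f (K.starProjection u) = inner 𝕜 f u := by
      have := horth f (hK v f hvf)
      rw [inner_sub_right, sub_eq_zero] at this
      exact this.symm
    calc ‖inner 𝕜 f (K.starProjection u)‖ = ‖inner 𝕜 w (V.starProjection v)‖ := by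
          rw [h4, ← norm_inner_symm, ← h3]
      _ ≤ ‖w‖ * ‖V.starProjection v‖ := norm_inner_le_norm _ _
      _ ≤ ‖w‖ * (C * ‖f‖) := by gcongr
      _ = C * ‖w‖ * ‖f‖ := by ring
  have h := key _ (K.starProjection_apply_mem u)
  rw [inner_self_eq_norm_sq_to_K, norm_pow, RCLike.norm_ofReal, abs_norm, sq] at h
  rcases (norm_nonneg (K.starProjection u)).eq_or_lt with h0 | h0
  · rw [← h0]
    positivity
  · exact le_of_mul_le_mul_right h h0

/-! ### Coercive operators -/

/-- If operators `a n` are uniformly bounded and uniformly coercive and `P` is the orthogonal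
projection onto `V`, then `P (a n) d n → 0` and `(1 - P) d n → 0` imply `d n → 0`. -/
lemma tendsto_zero_of_coercive {V : Submodule 𝕜 X} [V.HasOrthogonalProjection]
    {a : ℕ → X →L[𝕜] X} {C c : ℝ} (hC : ∀ n, ‖a n‖ ≤ C) (hc : 0 < c)
    (ha : ∀ n x, c * ‖x‖ ^ 2 ≤ RCLike.re (inner 𝕜 x (a n x))) {d : ℕ → X}
    (hP : Tendsto (fun n => V.starProjection (a n (d n))) atTop (𝓝 0))
    (hQ : Tendsto (fun n => d n - V.starProjection (d n)) atTop (𝓝 0)) :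
    Tendsto d atTop (𝓝 0) := by
  have hbound : ∀ n, ‖V.starProjection (d n)‖ ≤
      c⁻¹ * (‖V.starProjection (a n (d n))‖ + C * ‖d n - V.starProjection (d n)‖) := by
    intro n
    set p := V.starProjection (d n) with hp
    set q := d n - p with hq
    have hsplit : inner 𝕜 p (a n p) =
        inner 𝕜 p (V.starProjection (a n (d n))) - inner 𝕜 p (a n q) := by
      rw [← Submodule.inner_starProjection_left_eq_right,
        V.starProjection_eq_self_iff.2 (V.starProjection_apply_mem (d n)), hq, map_sub,
        inner_sub_right]
      ring
    have h : c * ‖p‖ * ‖p‖ ≤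
        (‖V.starProjection (a n (d n))‖ + C * ‖q‖) * ‖p‖ := by
      calc c * ‖p‖ * ‖p‖ = c * ‖p‖ ^ 2 := by ring
        _ ≤ RCLike.re (inner 𝕜 p (a n p)) := ha n p
        _ ≤ ‖inner 𝕜 p (a n p)‖ := RCLike.re_le_norm _
        _ ≤ ‖inner 𝕜 p (V.starProjection (a n (d n)))‖ + ‖inner 𝕜 p (a n q)‖ := by
            rw [hsplit]; exact norm_sub_le _ _
        _ ≤ ‖p‖ * ‖V.starProjection (a n (d n))‖ + ‖p‖ * (C * ‖q‖) := by
            gcongr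
            · exact norm_inner_le_norm _ _
            · exact (norm_inner_le_norm _ _).trans (by gcongr; exact (a n).le_of_opNorm_le (hC n) q)
        _ = _ := by ring
    rw [inv_mul_eq_div, le_div_iff₀ hc, mul_comm]
    rcases (norm_nonneg p).eq_or_lt with h0 | h0
    · have : 0 ≤ C := (norm_nonneg _).trans (hC n)
      rw [← h0, mul_zero]
      positivity
    · exact le_of_mul_le_mul_right h h0
  have hp : Tendsto (fun n => V.starProjection (d n)) atTop (𝓝 0) := by
    refine squeeze_zero_norm hbound ?_
    simpa using ((hP.norm.add (hQ.norm.const_mul C)).const_mul c⁻¹)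
  simpa using hQ.add hp

/-- If the component along `V` of uniformly bounded and uniformly coercive operators `a n` converges
strongly to that of `a₀` and `a₀` has an invertible compression to `V`, then a sequence `e` converges
as soon as its component along `Vᗮ` and the component of `a n (e n)` along `V` converge. -/
lemma exists_tendsto_of_coercive {V : Submodule 𝕜 X} [V.HasOrthogonalProjection]
    {a : ℕ → X →L[𝕜] X} {a₀ : X →L[𝕜] X} {C c : ℝ} (hC : ∀ n, ‖a n‖ ≤ C) (hc : 0 < c)
    (ha : ∀ n x, c * ‖x‖ ^ 2 ≤ RCLike.re (inner 𝕜 x (a n x))) (h₀ : IsUnit (block V V a₀))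
    (hlim : ∀ x, Tendsto (fun n => V.starProjection (a n x)) atTop (𝓝 (V.starProjection (a₀ x))))
    {e : ℕ → X} {y : X} (hy : Tendsto (fun n => e n - V.starProjection (e n)) atTop (𝓝 y))
    {g : V} (hg : Tendsto (fun n => V.starProjection (a n (e n))) atTop (𝓝 (g : X))) :
    ∃ x, Tendsto e atTop (𝓝 x) := by
  have hidem : ∀ x ∈ V, V.starProjection x = x := fun x hx => V.starProjection_eq_self_iff.2 hx
  -- The component of the limit along `V` solves an equation for the compression of `a₀`.
  obtain ⟨x, hxV, hx⟩ : ∃ x ∈ V, V.starProjection (a₀ (x + y)) = g := by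
    obtain ⟨b, hb⟩ := h₀.exists_right_inv
    let z : V := g - V.orthogonalProjectionOnto (a₀ y)
    have h1 : block V V a₀ (b z) = z := congrArg (fun T : V →L[𝕜] V => T z) hb
    have h2 : V.starProjection (a₀ (b z)) = g - V.starProjection (a₀ y) :=
      congrArg Subtype.val h1
    exact ⟨b z, (b z).2, by rw [map_add, map_add, h2, sub_add_cancel]⟩
  have hyV : V.starProjection y = 0 := by
    refine tendsto_nhds_unique ((V.starProjection.continuous.tendsto y).comp hy)
      (tendsto_const_nhds.congr fun n => ?_)
    rw [Function.comp_apply, map_sub, hidem _ (V.starProjection_apply_mem _), sub_self]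
  refine ⟨x + y, ?_⟩
  rw [← tendsto_sub_nhds_zero_iff]
  refine tendsto_zero_of_coercive hC hc ha (V := V) ?_ ?_
  · have h := hg.sub (hlim (x + y))
    rw [hx, sub_self] at h
    exact h.congr fun n => by rw [map_sub, map_sub]
  · have h := hy.sub_const y
    rw [sub_self] at h
    refine h.congr fun n => ?_
    rw [map_sub, map_add, hyV, hidem x hxV]
    abel

end Hilbert

/-! ### Pointwise and norm convergence of functionals -/

/-- A sequence in a relatively compact set of functionals that converges pointwise converges in
norm. -/
lemma tendsto_of_isCompact_closure_range {𝕜 X : Type*} [RCLike 𝕜] [NormedAddCommGroup X]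
    [NormedSpace 𝕜 X] {T : ℕ → StrongDual 𝕜 X} {S : StrongDual 𝕜 X}
    (hT : IsCompact (closure (Set.range T)))
    (h : ∀ x, Tendsto (fun n => T n x) atTop (𝓝 (S x))) : Tendsto T atTop (𝓝 S) := by
  refine hT.tendsto_nhds_of_unique_mapClusterPt
    (.of_forall fun n => subset_closure ⟨n, rfl⟩) fun R _ hR => ?_
  ext x
  have h1 : MapClusterPt (R x) atTop (fun n => T n x) :=
    hR.continuousAt_comp (f := fun R : StrongDual 𝕜 X => R x)
      (ContinuousLinearMap.apply 𝕜 𝕜 x).continuous.continuousAt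
  have : (𝓝 (R x) ⊓ 𝓝 (S x)).NeBot := ClusterPt.mono h1 (h x)
  exact eq_of_nhds_neBot this

variable {𝕜 : Type*} [RCLike 𝕜] {Ω : Opens R3}

/-! ### Gradient fields are curl-free -/

/-- The linear map that turns the derivative of a scalar function into its gradient. -/
noncomputable def gradOfFDeriv (𝕜 : Type*) [RCLike 𝕜] :
    (R3 →L[ℝ] 𝕜) →L[ℝ] EuclideanSpace 𝕜 (Fin 3) :=
  ((EuclideanSpace.equiv (Fin 3) 𝕜).symm.toContinuousLinearMap.restrictScalars ℝ).comp
    (ContinuousLinearMap.pi fun i => ContinuousLinearMap.apply ℝ 𝕜 (EuclideanSpace.single i 1))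

lemma gradOfFDeriv_apply (L : R3 →L[ℝ] 𝕜) (i : Fin 3) :
    gradOfFDeriv 𝕜 L i = L (EuclideanSpace.single i 1) := rfl

lemma classicalGrad_eq (φ : R3 → 𝕜) :
    classicalGrad φ = fun x => gradOfFDeriv 𝕜 (fderiv ℝ φ x) := by
  funext x
  ext i
  rw [gradOfFDeriv_apply]
  fin_cases i <;> simp [classicalGrad, partialD]

/-- The gradient of a scalar test function, as a test field. -/
noncomputable def gradTest (φ : TestFunction Ω 𝕜 ⊤) :
    TestFunction Ω (EuclideanSpace 𝕜 (Fin 3)) ⊤ where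
  toFun := classicalGrad φ
  contDiff' := by
    rw [classicalGrad_eq]
    exact (gradOfFDeriv 𝕜).contDiff.comp (φ.contDiff.fderiv_right (by simp))
  hasCompactSupport' := by
    rw [classicalGrad_eq]
    exact (φ.hasCompactSupport.fderiv ℝ).comp_left (map_zero _)
  tsupport_subset' := by
    rw [classicalGrad_eq]
    exact (tsupport_comp_subset (map_zero (gradOfFDeriv 𝕜)) _).trans
      ((tsupport_fderiv_subset ℝ).trans φ.tsupport_subset)

lemma classicalCurl_classicalGrad {φ : R3 → 𝕜} (hφ : ContDiff ℝ 2 φ) (x : R3) :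
    classicalCurl (classicalGrad φ) x = 0 := by
  have hd : DifferentiableAt ℝ (fderiv ℝ φ) x :=
    (hφ.fderiv_right (m := 1) (by norm_num)).differentiable (by simp) x
  have hpart : ∀ i j, partialD i (classicalGrad φ) x j =
      fderiv ℝ (fderiv ℝ φ) x (EuclideanSpace.single i 1) (EuclideanSpace.single j 1) := by
    intro i j
    have h := ((gradOfFDeriv 𝕜).hasFDerivAt.comp x hd.hasFDerivAt).fderiv
    rw [partialD, classicalGrad_eq]
    rw [show (fun x => gradOfFDeriv 𝕜 (fderiv ℝ φ x)) = gradOfFDeriv 𝕜 ∘ fderiv ℝ φ from rfl, h]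
    rfl
  have hsymm : IsSymmSndFDerivAt ℝ φ x := hφ.contDiffAt.isSymmSndFDerivAt (by simp)
  have hswap : ∀ i j, partialD i (classicalGrad φ) x j = partialD j (classicalGrad φ) x i :=
    fun i j => by rw [hpart, hpart]; exact hsymm.eq _ _
  ext i
  fin_cases i <;> simp [classicalCurl, sub_eq_zero] <;> exact hswap _ _

/-- A weak curl is orthogonal to the gradients: for a test function this is the definition of the
weak curl, tested with its gradient, whose curl vanishes. -/
lemma IsWeakCurl.inner_eq_zero {H K : L2Vec 𝕜 Ω} (h : IsWeakCurl Ω H K) {w : L2Vec 𝕜 Ω}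
    (hw : w ∈ ranGradZero 𝕜 Ω) : inner 𝕜 K w = 0 := by
  have htest : ∀ p ∈ testGrad 𝕜 Ω, inner 𝕜 K p.2 = 0 := by
    rintro p ⟨φ, -, hφ⟩
    have h1 := h (gradTest φ)
    have h2 : ∀ x, classicalCurl (gradTest φ) x = 0 := fun x =>
      classicalCurl_classicalGrad (φ.contDiff.of_le (WithTop.coe_le_coe.2 le_top)) x
    simp only [h2, inner_zero_left, integral_zero] at h1
    rw [← inner_conj_symm, L2.inner_def, integral_congr_ae
      (g := fun x => inner 𝕜 (gradTest φ x) (K x)), ← h1, map_zero]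
    filter_upwards [hφ] with x hx
    rw [hx]
    rfl
  have hgrad : ∀ p ∈ gradZero 𝕜 Ω, inner 𝕜 K p.2 = 0 := fun p hp =>
    closure_minimal (s := (testGrad 𝕜 Ω : Set (L2 𝕜 Ω × L2Vec 𝕜 Ω)))
      (t := {p | inner 𝕜 K p.2 = 0}) htest (isClosed_eq (by fun_prop) (by fun_prop)) hp
  refine closure_minimal (t := {w | inner 𝕜 K w = 0}) ?_
    (isClosed_eq (by fun_prop) (by fun_prop)) hw
  rintro _ ⟨p, hp, rfl⟩
  exact hgrad p hp

lemma mem_curlZero_of_mem_ranGradZero {w : L2Vec 𝕜 Ω} (hw : w ∈ ranGradZero 𝕜 Ω) :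
    (w, (0 : L2Vec 𝕜 Ω)) ∈ curlZero 𝕜 Ω := fun H K h => by
  rw [inner_zero_right]
  exact IsWeakCurl.inner_eq_zero h hw

/-! ### The divergence and the orthogonal projection to the gradients -/

lemma mem_divergence_iff {F : L2Vec 𝕜 Ω} {f : L2 𝕜 Ω} :
    (F, f) ∈ divergence 𝕜 Ω ↔
      ∀ u w, (u, w) ∈ gradZero 𝕜 Ω → inner 𝕜 w F + inner 𝕜 u f = 0 := by
  have : (F, f) ∈ divergence 𝕜 Ω ↔ (F, -f) ∈ (gradZero 𝕜 Ω).adjoint := Iff.rfl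
  rw [this, Submodule.mem_adjoint_iff]
  simp

lemma snd_mem_ranGradZero {u : L2 𝕜 Ω} {w : L2Vec 𝕜 Ω} (h : (u, w) ∈ gradZero 𝕜 Ω) :
    w ∈ ranGradZero 𝕜 Ω :=
  Submodule.le_topologicalClosure _ ⟨(u, w), h, rfl⟩

lemma sub_starProjection_mem_divergence (F : L2Vec 𝕜 Ω) :
    (F - (ranGradZero 𝕜 Ω).starProjection F, (0 : L2 𝕜 Ω)) ∈ divergence 𝕜 Ω :=
  mem_divergence_iff.2 fun u w h => by
    rw [inner_zero_right, add_zero]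
    exact (Submodule.mem_orthogonal _ _).1
      (Submodule.sub_starProjection_mem_orthogonal F) w (snd_mem_ranGradZero h)

lemma starProjection_mem_divergence {F : L2Vec 𝕜 Ω} {f : L2 𝕜 Ω}
    (h : (F, f) ∈ divergence 𝕜 Ω) :
    ((ranGradZero 𝕜 Ω).starProjection F, f) ∈ divergence 𝕜 Ω := by
  simpa using (divergence 𝕜 Ω).sub_mem h (sub_starProjection_mem_divergence F)

/-! ### Consequences of the electric compactness property -/

/-- Sequences that are bounded in the graph norm have strongly convergent subsequences. -/
lemma ElectricCompactness.exists_tendsto (hΩ : ElectricCompactness 𝕜 Ω) {E : ℕ → L2Vec 𝕜 Ω}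
    {f : ℕ → L2 𝕜 Ω} {G : ℕ → L2Vec 𝕜 Ω} (hf : ∀ n, (E n, f n) ∈ divergence 𝕜 Ω)
    (hG : ∀ n, (E n, G n) ∈ curlZero 𝕜 Ω) (hE_bdd : ∃ C : ℝ, ∀ n, ‖E n‖ ≤ C)
    (hf_bdd : ∃ C : ℝ, ∀ n, ‖f n‖ ≤ C) (hG_bdd : ∃ C : ℝ, ∀ n, ‖G n‖ ≤ C) :
    ∃ (E_lim : L2Vec 𝕜 Ω) (k : ℕ → ℕ),
      StrictMono k ∧ Tendsto (fun n => E (k n)) atTop (𝓝 E_lim) := by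
  obtain ⟨C₁, h₁⟩ := hE_bdd
  obtain ⟨C₂, h₂⟩ := hf_bdd
  obtain ⟨C₃, h₃⟩ := hG_bdd
  -- Scaling by `1 / r` moves the sequence into the unit ball of the graph norm.
  set r : ℝ := 1 + C₁ ^ 2 + C₂ ^ 2 + C₃ ^ 2 with hr
  have hr1 : 1 ≤ r := by rw [hr]; nlinarith [sq_nonneg C₁, sq_nonneg C₂, sq_nonneg C₃]
  have hr0 : (r : 𝕜) ≠ 0 := by exact_mod_cast (by positivity : r ≠ 0)
  have hball : ∀ n, ((r : 𝕜)⁻¹) • E n ∈ closure {E : L2Vec 𝕜 Ω | ∃ (f : L2 𝕜 Ω) (G : L2Vec 𝕜 Ω),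
      (E, f) ∈ divergence 𝕜 Ω ∧ (E, G) ∈ curlZero 𝕜 Ω ∧
        ‖E‖ ^ 2 + ‖f‖ ^ 2 + ‖G‖ ^ 2 ≤ 1} := by
    intro n
    refine subset_closure ⟨(r : 𝕜)⁻¹ • f n, (r : 𝕜)⁻¹ • G n,
      (divergence 𝕜 Ω).smul_mem _ (hf n), (curlZero 𝕜 Ω).smul_mem _ (hG n), ?_⟩
    simp only [norm_smul, norm_inv, RCLike.norm_ofReal, abs_of_pos (zero_lt_one.trans_le hr1),
      mul_pow, ← mul_add]
    rw [inv_pow, inv_mul_le_one₀ (by positivity)]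
    have e₁ := pow_le_pow_left₀ (norm_nonneg _) (h₁ n) 2
    have e₂ := pow_le_pow_left₀ (norm_nonneg _) (h₂ n) 2
    have e₃ := pow_le_pow_left₀ (norm_nonneg _) (h₃ n) 2
    nlinarith
  obtain ⟨a, -, k, hk, ha⟩ := hΩ.tendsto_subseq hball
  refine ⟨(r : 𝕜) • a, k, hk, ?_⟩
  simpa [Function.comp_def, smul_smul, hr0] using ha.const_smul (r : 𝕜)

/-- On the closure of the gradients, which is orthogonal to the kernel of the divergence, the
divergence is bounded below. -/
lemma ElectricCompactness.exists_norm_le_divergence (hΩ : ElectricCompactness 𝕜 Ω) :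
    ∃ C : ℝ, 0 ≤ C ∧ ∀ v ∈ ranGradZero 𝕜 Ω, ∀ f, (v, f) ∈ divergence 𝕜 Ω → ‖v‖ ≤ C * ‖f‖ := by
  by_contra! hcon
  choose v hv f hf hlt using fun n : ℕ => hcon (n + 1) (by positivity)
  have hpos : ∀ n, 0 < ‖v n‖ := fun n => lt_of_le_of_lt (by positivity) (hlt n)
  have hne : ∀ n, (‖v n‖ : 𝕜) ≠ 0 := fun n => by exact_mod_cast (hpos n).ne'
  set s : ℕ → L2Vec 𝕜 Ω := fun n => (‖v n‖ : 𝕜)⁻¹ • v n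
  set t : ℕ → L2 𝕜 Ω := fun n => (‖v n‖ : 𝕜)⁻¹ • f n
  have hs : ∀ n, ‖s n‖ = 1 := fun n => by
    simp [s, norm_smul, inv_mul_cancel₀ (hpos n).ne']
  have hsV : ∀ n, s n ∈ ranGradZero 𝕜 Ω := fun n => Submodule.smul_mem _ _ (hv n)
  have hst : ∀ n, (s n, t n) ∈ divergence 𝕜 Ω := fun n =>
    (divergence 𝕜 Ω).smul_mem _ (hf n)
  have ht : ∀ n, ‖t n‖ ≤ 1 / ((n : ℝ) + 1) := fun n => by
    rw [norm_smul, norm_inv, RCLike.norm_ofReal, abs_norm, inv_mul_le_iff₀ (hpos n),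
      mul_one_div, le_div_iff₀ (by positivity), mul_comm]
    exact (hlt n).le
  have ht0 : Tendsto t atTop (𝓝 0) :=
    squeeze_zero_norm ht tendsto_one_div_add_atTop_nhds_zero_nat
  obtain ⟨a, k, hk, ha⟩ := hΩ.exists_tendsto hst
    (fun n => mem_curlZero_of_mem_ranGradZero (hsV n)) ⟨1, fun n => (hs n).le⟩
    ⟨1, fun n => (ht n).trans (by
      rw [div_le_one₀ (by positivity)]; linarith [n.cast_nonneg (α := ℝ)])⟩
    ⟨0, fun n => by simp⟩
  have ha1 : ‖a‖ = 1 := tendsto_nhds_unique ha.norm (by simp [hs])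
  have haV : a ∈ ranGradZero 𝕜 Ω :=
    (Submodule.isClosed_topologicalClosure _).mem_of_tendsto ha (.of_forall fun n => hsV (k n))
  -- The limit is orthogonal to all gradients, and it belongs to their closure.
  have horth : ∀ p ∈ gradZero 𝕜 Ω, inner 𝕜 p.2 a = 0 := fun p hp => by
    have h1 : Tendsto (fun n => inner 𝕜 p.2 (s (k n)) + inner 𝕜 p.1 (t (k n))) atTop
        (𝓝 (inner 𝕜 p.2 a + inner 𝕜 p.1 0)) :=
      (tendsto_const_nhds.inner ha).add
        (tendsto_const_nhds.inner (ht0.comp hk.tendsto_atTop))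
    simp only [fun n => mem_divergence_iff.1 (hst (k n)) p.1 p.2 hp, inner_zero_right,
      add_zero] at h1
    exact tendsto_nhds_unique h1 tendsto_const_nhds |>.symm ▸ rfl
  have haa : inner 𝕜 a a = 0 := by
    refine closure_minimal (t := {w | inner 𝕜 w a = 0}) ?_
      (isClosed_eq (by fun_prop) (by fun_prop)) haV
    rintro _ ⟨p, hp, rfl⟩
    exact horth p hp
  rw [inner_self_eq_zero] at haa
  simp [haa] at ha1

/-- A Poincaré inequality: every gradient `w` has a potential in `H₀¹(Ω)` whose norm is bounded by
that of `w`. -/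
lemma ElectricCompactness.exists_potential (hΩ : ElectricCompactness 𝕜 Ω) :
    ∃ C : ℝ, 0 ≤ C ∧ ∀ u w, (u, w) ∈ gradZero 𝕜 Ω →
      ∃ u₀, (u₀, w) ∈ gradZero 𝕜 Ω ∧ ‖u₀‖ ≤ C * ‖w‖ := by
  obtain ⟨C, hC₀, hC⟩ := hΩ.exists_norm_le_divergence
  refine ⟨C, hC₀, fun u w huw => exists_preimage_norm_le (V := ranGradZero 𝕜 Ω)
    (Submodule.isClosed_topologicalClosure _) (fun u w h => snd_mem_ranGradZero h) hC₀
    (fun v hv f hf => ?_) huw⟩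
  rw [← norm_neg f]
  refine hC v hv (-f) ?_
  rwa [← neg_neg f] at hf

lemma divDist_apply (F : L2Vec 𝕜 Ω) (p : H01 𝕜 Ω) :
    divDist Ω F p = -inner 𝕜 F p.1.snd := rfl

/-- The `H⁻¹(Ω)` norm of the divergence controls the component along the gradients. -/
lemma ElectricCompactness.exists_norm_starProjection_le (hΩ : ElectricCompactness 𝕜 Ω) :
    ∃ C : ℝ, ∀ F : L2Vec 𝕜 Ω, ‖(ranGradZero 𝕜 Ω).starProjection F‖ ≤ C * ‖divDist Ω F‖ := by
  obtain ⟨C, hC₀, hC⟩ := hΩ.exists_potential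
  refine ⟨C + 1, fun F => ?_⟩
  have key : ∀ w ∈ ranGradZero 𝕜 Ω, ‖inner 𝕜 F w‖ ≤ (C + 1) * ‖divDist Ω F‖ * ‖w‖ := by
    intro w hw
    refine closure_minimal (t := {w | ‖inner 𝕜 F w‖ ≤ (C + 1) * ‖divDist Ω F‖ * ‖w‖}) ?_
      (isClosed_le (by fun_prop) (by fun_prop)) hw
    rintro _ ⟨⟨u, w⟩, hp, rfl⟩
    change ‖inner 𝕜 F w‖ ≤ (C + 1) * ‖divDist Ω F‖ * ‖w‖
    obtain ⟨u₀, hu₀, hle⟩ := hC u w hp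
    let p : H01 𝕜 Ω := ⟨WithLp.toLp 2 (u₀, w), hu₀⟩
    have hp : ‖p‖ ≤ (C + 1) * ‖w‖ := by
      have hsq : ‖p‖ ^ 2 = ‖u₀‖ ^ 2 + ‖w‖ ^ 2 := WithLp.prod_norm_sq_eq_of_L2 _
      have := norm_nonneg u₀
      have := norm_nonneg w
      refine le_of_sq_le_sq ?_ (by positivity)
      rw [hsq]
      nlinarith [pow_le_pow_left₀ (norm_nonneg _) hle 2, mul_nonneg hC₀ (sq_nonneg ‖w‖)]
    calc ‖inner 𝕜 F w‖ = ‖divDist Ω F p‖ := (norm_neg (inner 𝕜 F w)).symm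
      _ ≤ ‖divDist Ω F‖ * ‖p‖ := (divDist Ω F).le_opNorm p
      _ ≤ ‖divDist Ω F‖ * ((C + 1) * ‖w‖) := by gcongr
      _ = _ := by ring
  set P := (ranGradZero 𝕜 Ω).starProjection F
  have hP : P ∈ ranGradZero 𝕜 Ω := Submodule.starProjection_apply_mem _ _
  have h := key P hP
  have h' : inner 𝕜 F P = inner 𝕜 P P := by
    rw [← sub_eq_zero, ← inner_sub_left]
    exact Submodule.starProjection_inner_eq_zero _ _ hP
  rw [h', inner_self_eq_norm_sq_to_K, norm_pow, RCLike.norm_ofReal, abs_norm, sq] at h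
  rcases (norm_nonneg P).eq_or_lt with h0 | h0
  · rw [← h0]
    positivity
  · exact le_of_mul_le_mul_right h h0

lemma divDist_sub (F F' : L2Vec 𝕜 Ω) : divDist Ω (F - F') = divDist Ω F - divDist Ω F' := by
  ext p
  simp only [divDist_apply, sub_apply, inner_sub_left]
  ring

/-- For a weakly convergent sequence, relative compactness of the divergences in `H⁻¹(Ω)` makes the
components along the gradients converge strongly. -/
lemma ElectricCompactness.tendsto_starProjection (hΩ : ElectricCompactness 𝕜 Ω)
    {F : ℕ → L2Vec 𝕜 Ω} {F₀ : L2Vec 𝕜 Ω}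
    (hdiv : IsCompact (closure (Set.range fun n => divDist Ω (F n))))
    (hF : ∀ w, Tendsto (fun n => inner 𝕜 w (F n)) atTop (𝓝 (inner 𝕜 w F₀))) :
    Tendsto (fun n => (ranGradZero 𝕜 Ω).starProjection (F n)) atTop
      (𝓝 ((ranGradZero 𝕜 Ω).starProjection F₀)) := by
  have h : Tendsto (fun n => divDist Ω (F n)) atTop (𝓝 (divDist Ω F₀)) := by
    refine tendsto_of_isCompact_closure_range hdiv fun p => ?_
    simp only [divDist_apply]
    simpa only [RCLike.star_def, inner_conj_symm] using (hF p.1.snd).star.neg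
  obtain ⟨C, hC⟩ := hΩ.exists_norm_starProjection_le
  have h' := ((tendsto_iff_norm_sub_tendsto_zero (E := HNeg1 𝕜 Ω)).1 h).const_mul C
  rw [mul_zero] at h'
  rw [tendsto_iff_norm_sub_tendsto_zero]
  refine squeeze_zero (fun n => norm_nonneg _) (fun n => ?_) h'
  rw [← map_sub, ← divDist_sub]
  exact hC _

end ElectroStatics

/-! ### Compactness of the electric fields -/

open ElectroStatics in
theorem theoremD {𝕜 : Type*} [RCLike 𝕜] (Ω : Opens ElectroStatics.R3)
    (hΩ : ElectroStatics.ElectricCompactness 𝕜 Ω)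
    (ε : ℕ → ElectroStatics.L2Vec 𝕜 Ω →L[𝕜] ElectroStatics.L2Vec 𝕜 Ω)
    (ε₀ : ElectroStatics.L2Vec 𝕜 Ω →L[𝕜] ElectroStatics.L2Vec 𝕜 Ω)
    (hε_bdd : ∃ C : ℝ, ∀ n, ‖ε n‖ ≤ C)
    (hε_coercive : ∃ c : ℝ, 0 < c ∧
      ∀ n (F : ElectroStatics.L2Vec 𝕜 Ω), c * ‖F‖ ^ 2 ≤ RCLike.re (inner 𝕜 F (ε n F)))
    (hε_div : ∀ F : ElectroStatics.L2Vec 𝕜 Ω,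
      IsCompact (closure (Set.range fun n => ElectroStatics.divDist Ω (ε n F))))
    (hε_wot : Tendsto (fun n => ContinuousLinearMapWOT.ofCLM (ε n)) atTop
      (𝓝 (ContinuousLinearMapWOT.ofCLM ε₀)))
    (hε_bH : ElectroStatics.TendstoBoundedSchur (ElectroStatics.ranGradZero 𝕜 Ω) ε ε₀)
    (E : ℕ → ElectroStatics.L2Vec 𝕜 Ω) (hE_bdd : ∃ C : ℝ, ∀ n, ‖E n‖ ≤ C)
    (f : ℕ → ElectroStatics.L2 𝕜 Ω)
    (hf : ∀ n, (ε n (E n), f n) ∈ ElectroStatics.divergence 𝕜 Ω)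
    (hf_bdd : ∃ C : ℝ, ∀ n, ‖f n‖ ≤ C)
    (G : ℕ → ElectroStatics.L2Vec 𝕜 Ω)
    (hG : ∀ n, (E n, G n) ∈ ElectroStatics.curlZero 𝕜 Ω)
    (hG_bdd : ∃ C : ℝ, ∀ n, ‖G n‖ ≤ C) :
    ∃ (E_lim : ElectroStatics.L2Vec 𝕜 Ω) (k : ℕ → ℕ),
      StrictMono k ∧ Tendsto (fun n => E (k n)) atTop (𝓝 E_lim) := by
  obtain ⟨Cε, hCε⟩ := hε_bdd
  obtain ⟨c, hc, hcoer⟩ := hε_coercive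
  obtain ⟨CE, hCE⟩ := hE_bdd
  -- The component of `E n` orthogonal to the gradients is divergence-free and inherits the curl.
  have hcurl : ∀ n, (E n - (ranGradZero 𝕜 Ω).starProjection (E n), G n) ∈ curlZero 𝕜 Ω :=
    fun n => by
      have h := (curlZero 𝕜 Ω).sub_mem (hG n)
        (mem_curlZero_of_mem_ranGradZero (Submodule.starProjection_apply_mem _ (E n)))
      rwa [Prod.mk_sub_mk, sub_zero] at h
  obtain ⟨y, k₁, hk₁, hy⟩ := hΩ.exists_tendsto (f := fun _ => 0)
    (fun n => sub_starProjection_mem_divergence (E n)) hcurl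
    ⟨CE + CE, fun n => (norm_sub_le _ _).trans
      (add_le_add (hCE n) ((Submodule.norm_starProjection_apply_le _ _).trans (hCE n)))⟩
    ⟨0, fun _ => norm_zero.le⟩ hG_bdd
  -- The component of `ε n (E n)` along the gradients is curl-free and inherits the divergence.
  obtain ⟨g, k₂, hk₂, hg⟩ := hΩ.exists_tendsto (G := fun _ => 0)
    (fun n => starProjection_mem_divergence (hf (k₁ n)))
    (fun n => mem_curlZero_of_mem_ranGradZero (Submodule.starProjection_apply_mem _ _))
    ⟨Cε * CE, fun n => (Submodule.norm_starProjection_apply_le _ _).trans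
      ((ε (k₁ n)).le_of_opNorm_le_of_le (hCε _) (hCE _))⟩
    (hf_bdd.imp fun C h n => h (k₁ n)) ⟨0, fun n => norm_zero.le⟩
  have hgV : g ∈ ranGradZero 𝕜 Ω :=
    (Submodule.isClosed_topologicalClosure _).mem_of_tendsto hg
      (.of_forall fun n => Submodule.starProjection_apply_mem _ _)
  have hk : StrictMono (k₁ ∘ k₂) := hk₁.comp hk₂
  have hlim : ∀ F, Tendsto (fun n => (ranGradZero 𝕜 Ω).starProjection (ε n F)) atTop
      (𝓝 ((ranGradZero 𝕜 Ω).starProjection (ε₀ F))) := fun F =>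
    hΩ.tendsto_starProjection (hε_div F) fun w =>
      ContinuousLinearMapWOT.tendsto_iff_forall_inner_apply_tendsto.1 hε_wot F w
  obtain ⟨-, h₀, -⟩ := hε_bH
  obtain ⟨x, hx⟩ := exists_tendsto_of_coercive (fun n => hCε (k₁ (k₂ n))) hc
    (fun n => hcoer (k₁ (k₂ n))) h₀.2 (fun F => (hlim F).comp hk.tendsto_atTop)
    (hy.comp hk₂.tendsto_atTop) (g := ⟨g, hgV⟩) hg
  exact ⟨x, k₁ ∘ k₂, hk, hx⟩
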